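/- Let $R=\Bbbk[x_1,\dots,x_n]$ be a polynomial ring over a field $\Bbbk$. A squarefree monomial ideal is an ideal generated by squarefree monomials (the ideals $0$ and $R$ are included). For an ideal $I\subseteq R$ let $\operatorname{Ass}(I)$ be the set of associated primes of $R/I$, let $\overline{I}$ be the integral closure of $I$, and for $s\ge 1$ let $I^{(s)}=\bigcap_{\mathfrak p\in\operatorname{Ass}(I)}(I^sR_{\mathfrak p}\cap R)$ be its $s$-th symbolic power. Write $I^{(\bullet)}=\{I^{(i)}\}_{i\ge1}$ and $\overline{I^\bullet}=\{\overline{I^i}\}_{i\ge1}$. For families $\mathfrak a_\bullet=\{\mathfrak a_i\}_{i\ge 1}$ and $\mathfrak b_\bullet=\{\mathfrak b_i\}_{i\ge 1}$ of ideals of $R$ the asymptotic resurgence is $$\widehat\rho(\mathfrak a_\bullet,\mathfrak b_\bullet)=\sup\left\{\tfrac{s}{r}\;\middle|\; s,r\ge 1 \text{ integers},\ \mathfrak a_{st}\not\subseteq\mathfrak b_{rt}\text{ for } t\gg0\right\}\in[-\infty,\infty],\qquad \sup\emptyset=-\infty .$$ For a squarefree monomial ideal $I$ let $$I^\vee=\Big\langle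 \prod_{x_i\in\mathfrak p}x_i\;\Big|\;\mathfrak p\in\operatorname{Ass}(I)\Big\rangle$$ be its Alexander dual and let $$\operatorname{SP}(I)=\Big\{u\in\mathbb R_{\ge0}^n\;\Big|\;\sum_{x_i\in\mathfrak p}u_i\ge1\text{ for all }\mathfrak p\in\operatorname{Ass}(I)\Big\}$$ be its symbolic polyhedron. Let $\mathfrak a$ and $\mathfrak b$ be squarefree monomial ideals of $R$. If $\mathfrak a\ne 0$ and $\mathfrak b\ne R$, then the minimum below exists and $$\widehat\rho(\mathfrak a^{(\bullet)},\overline{\mathfrak b^\bullet})=\frac{1}{\min\{\langle u,v\rangle\mid u\in\operatorname{SP}(\mathfrak a),\ v\in\operatorname{SP}(\mathfrak b^\vee)\}}=\widehat\rho\big((\mathfrak b^\vee)^{(\bullet)},\overline{(\mathfrak a^\vee)^\bullet}\big),$$ where $\langle\cdot,\cdot\rangle$ is the usual dot product on $\mathbb R^n$ and $\frac10=\infty$. The equality $\widehat\rho(\mathfrak a^{(\bullet)},\overline{\mathfrak b^\bullet})=\widehat\rho((\mathfrak b^\vee)^{(\bullet)},\overline{(\mathfrak a^\vee)^\bullet})$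 holds without assuming $\mathfrak a\neq 0$ or $\mathfrak b\neq R$. In particular, for any squarefree monomial ideal $\mathfrak a$, $$\widehat\rho(\mathfrak a^{(\bullet)},\overline{\mathfrak a^\bullet})=\widehat\rho\big((\mathfrak a^\vee)^{(\bullet)},\overline{(\mathfrak a^\vee)^\bullet}\big).$$ -/

import Mathlib

namespace MonomialResurgence

open MvPolynomial Filter

section General

variable {R : Type*} [CommRing R]

/-- `x` is integral over the ideal `I`: it satisfies an equation
`x ^ m + c 1 * x ^ (m - 1) + ⋯ + c m = 0` with `m ≥ 1` and `c j ∈ I ^ j` for `1 ≤ j ≤ m`. -/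
def IsIntegralOver (I : Ideal R) (x : R) : Prop :=
  ∃ (m : ℕ) (c : ℕ → R), 1 ≤ m ∧ (∀ j ∈ Finset.Icc 1 m, c j ∈ I ^ j) ∧
    x ^ m + ∑ j ∈ Finset.Icc 1 m, c j * x ^ (m - j) = 0

open scoped Polynomial in
/-- `x` is integral over `I` if and only if `x T` is integral over the Rees algebra `R[I T]`. -/
theorem isIntegralOver_iff_rees (I : Ideal R) (x : R) :
    IsIntegralOver I x ↔ IsIntegral (reesAlgebra I) (Polynomial.monomial 1 x : R[X]) := by
  classical
  constructor
  · rintro ⟨m, c, hm, hc, h⟩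
    let Q : (reesAlgebra I)[X] := ∑ j ∈ Finset.Icc 1 m,
      if hj : c j ∈ I ^ j then
        Polynomial.monomial (m - j) ⟨Polynomial.monomial j (c j), reesAlgebra.monomial_mem.mpr hj⟩
      else 0
    have hQ : Q.degree < m := by
      refine (Polynomial.degree_sum_le _ _).trans_lt ?_
      rw [Finset.sup_lt_iff (by exact WithBot.bot_lt_coe m)]
      intro j hj
      rw [dif_pos (hc j hj)]
      refine (Polynomial.degree_monomial_le _ _).trans_lt ?_
      have := Finset.mem_Icc.mp hj
      exact_mod_cast (by omega : m - j < m)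
    refine ⟨Polynomial.X ^ m + Q, Polynomial.monic_X_pow_add hQ, ?_⟩
    have h1 : Polynomial.eval₂ (algebraMap (reesAlgebra I) R[X]) (Polynomial.monomial 1 x) Q
        = ∑ j ∈ Finset.Icc 1 m, Polynomial.monomial m (c j * x ^ (m - j)) := by
      simp only [Q, Polynomial.eval₂_finsetSum]
      refine Finset.sum_congr rfl fun j hj => ?_
      rw [dif_pos (hc j hj), Polynomial.eval₂_monomial, Polynomial.monomial_pow, one_mul]
      change Polynomial.monomial j (c j) * _ = _
      rw [Polynomial.monomial_mul_monomial, Nat.add_sub_cancel' (Finset.mem_Icc.mp hj).2]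
    rw [Polynomial.eval₂_add, h1, Polynomial.eval₂_X_pow, Polynomial.monomial_pow, one_mul,
      ← map_sum, ← map_add, h, map_zero]
  · rintro ⟨p, hp, h⟩
    rcases Nat.eq_zero_or_pos p.natDegree with h0 | h0
    · rw [hp.natDegree_eq_zero.mp h0, Polynomial.eval₂_one] at h
      have : Subsingleton R := by
        rw [← Polynomial.subsingleton_iff_subsingleton]
        exact subsingleton_of_zero_eq_one h.symm
      exact ⟨1, 0, le_rfl, fun j _ => by simp, Subsingleton.elim _ _⟩
    · refine ⟨p.natDegree, fun j => (p.coeff (p.natDegree - j)).1.coeff j, h0,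
        fun j _ => (p.coeff (p.natDegree - j)).2 j, ?_⟩
      have h2 := congrArg (fun f : R[X] => f.coeff p.natDegree) h
      simp only [Polynomial.eval₂_eq_sum_range, Polynomial.finsetSum_coeff,
        Polynomial.coeff_zero] at h2
      rw [← Finset.sum_range_reflect, Finset.sum_range_succ'] at h2
      rw [← h2, add_comm, Finset.range_eq_Ico, Finset.sum_Ico_add' (fun j =>
        ((algebraMap (reesAlgebra I) R[X]) (p.coeff (p.natDegree + 1 - 1 - j)) *
          Polynomial.monomial 1 x ^ (p.natDegree + 1 - 1 - j)).coeff p.natDegree) 0 p.natDegree 1]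
      congr 1
      · refine Finset.sum_congr (by ext; simp) fun j hj => ?_
        have hj' := Finset.mem_Ico.mp hj
        have e : p.natDegree = j + (p.natDegree - j) := by omega
        rw [Nat.add_sub_cancel, Polynomial.monomial_pow, one_mul,
          ← Polynomial.C_mul_X_pow_eq_monomial, ← mul_assoc]
        conv_rhs => rw [e]
        simp only [Nat.add_sub_cancel_left]
        rw [Polynomial.coeff_mul_X_pow, Polynomial.coeff_mul_C]
        rfl
      · simp [hp.coeff_natDegree, Polynomial.monomial_pow]

/-- The integral closure of an ideal. -/
def idealClosure (I : Ideal R) : Ideal R where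
  carrier := {x | IsIntegralOver I x}
  zero_mem' := by
    refine ⟨1, 0, le_rfl, fun j _ => by simp, by simp⟩
  add_mem' := by
    intro x y hx hy
    simp only [Set.mem_ofPred_eq, isIntegralOver_iff_rees] at *
    rw [map_add]
    exact hx.add hy
  smul_mem' := by
    rintro r x ⟨m, c, hm, hc, h⟩
    refine ⟨m, fun j => r ^ j * c j, hm, fun j hj => Ideal.mul_mem_left _ _ (hc j hj), ?_⟩
    have h2 : ∑ j ∈ Finset.Icc 1 m, r ^ j * c j * (r • x) ^ (m - j)
        = r ^ m * ∑ j ∈ Finset.Icc 1 m, c j * x ^ (m - j) := by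
      rw [Finset.mul_sum]
      refine Finset.sum_congr rfl fun j hj => ?_
      have : m = j + (m - j) := by have := (Finset.mem_Icc.mp hj).2; omega
      conv_rhs => rw [this, pow_add]
      simp only [smul_eq_mul, mul_pow, Nat.add_sub_cancel_left]
      ring
    rw [h2, smul_eq_mul, mul_pow, ← mul_add, h, mul_zero]

/-- The symbolic power `I ^ (s)`: the intersection of the contractions to `R` of the localized
ideals `I ^ s R_p`, over all associated primes `p` of `R ⧸ I`. -/
def symbolicPower (I : Ideal R) (s : ℕ) : Ideal R :=
  ⨅ (p : Ideal R) (hp : p ∈ associatedPrimes R (R ⧸ I)),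
    haveI : p.IsPrime := IsAssociatedPrime.isPrime hp
    ((I ^ s).map (algebraMap R (Localization.AtPrime p))).comap
      (algebraMap R (Localization.AtPrime p))

/-- The asymptotic resurgence of a pair of families of ideals, the supremum of all `s / r` with
`s, r ≥ 1` such that `A (s t)` is not contained in `B (r t)` for all large `t`. The supremum is
taken in the extended reals: it is `-∞` for the empty set and `∞` for an unbounded set. -/
noncomputable def asympResurgence (A B : ℕ → Ideal R) : EReal :=
  sSup {q : EReal | ∃ s r : ℕ, 1 ≤ s ∧ 1 ≤ r ∧
    (∀ᶠ t : ℕ in atTop, ¬ A (s * t) ≤ B (r * t)) ∧ q = (((s : ℝ) / (r : ℝ) : ℝ) : EReal)}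

/-- The asymptotic resurgence of the symbolic powers of `I` with respect to the integral closures
of the powers of `J`. -/
noncomputable def rhoHat (I J : Ideal R) : EReal :=
  asympResurgence (fun s => symbolicPower I s) (fun r => idealClosure (J ^ r))

end General

section Monomial

variable {k : Type*} [Field k] {n : ℕ}

/-- An ideal generated by squarefree monomials (the zero and the unit ideal included). -/
def IsSquarefreeMonomial (I : Ideal (MvPolynomial (Fin n) k)) : Prop :=
  ∃ S : Set (Finset (Fin n)), I = Ideal.span ((fun F => ∏ i ∈ F, (X i : MvPolynomial (Fin n) k)) '' S)

open Classical in
/-- The indices of the variables that lie in `p`. -/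
noncomputable def varsIn (p : Ideal (MvPolynomial (Fin n) k)) : Finset (Fin n) :=
  Finset.univ.filter (fun i => (X i : MvPolynomial (Fin n) k) ∈ p)

/-- The Alexander dual of `I`, generated by the products of the variables in `p`, one product for
each associated prime `p` of `I`. -/
noncomputable def alexanderDual (I : Ideal (MvPolynomial (Fin n) k)) :
    Ideal (MvPolynomial (Fin n) k) :=
  Ideal.span ((fun p : Ideal (MvPolynomial (Fin n) k) =>
    ∏ i ∈ varsIn p, (X i : MvPolynomial (Fin n) k)) '' associatedPrimes (MvPolynomial (Fin n) k) (MvPolynomial (Fin n) k ⧸ I))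

/-- The symbolic polyhedron of `I`: the points `u` of the nonnegative orthant with
`∑_{x_i ∈ p} u_i ≥ 1` for each associated prime `p` of `I`. -/
def symbolicPolyhedron (I : Ideal (MvPolynomial (Fin n) k)) : Set (Fin n → ℝ) :=
  {u | (∀ i, 0 ≤ u i) ∧
    ∀ p ∈ associatedPrimes (MvPolynomial (Fin n) k) (MvPolynomial (Fin n) k ⧸ I),
      1 ≤ ∑ i ∈ varsIn p, u i}

end Monomial

end MonomialResurgence

namespace MonomialResurgence

open MvPolynomial Filter

variable {k : Type*} [Field k] {n : ℕ}

/-! Encode a squarefree monomial ideal by a family `S` of supports. Its associated primes are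
generated by the minimal sets meeting every member of `S`, so Alexander duality replaces `S` by
`covers S`, and doing this twice gives the upward closure of `S`. Hence, for `a` given by `S` and
`b` given by `T`, SP(a) is the covering polyhedron of `covers S` and SP(b^∨) is that of `T`.

Both families of ideals are read off from exponents. A monomial x^e lies in a^(s) iff e ∈ s·SP(a)
(`mem_symbolicPower_iff`). It is integral over b^r iff ⟨e,v⟩ ≥ r on SP(b^∨): weights give necessity,
linear programming duality gives sufficiency. Let m be the minimum of ⟨u,v⟩. If sm ≥ r, scaling
gives containment for every t ≥ 1. If sm < r, rounding up st·u at a minimizer costs a bounded amount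
while the gap t(r - sm) grows, so containment eventually fails (`eventually_not_le_iff`). The
supremum of the s/r with sm < r is 1/m.

Replacing (S, T) by (`covers T`, `covers S`) swaps the two polyhedra, whence the duality. When a = 0
or b = R, both sides are -∞. -/

/-- The ideal generated by the squarefree monomials with supports in `S`. -/
noncomputable def sqfreeIdeal (k : Type*) [Field k] {n : ℕ} (S : Set (Finset (Fin n))) :
    Ideal (MvPolynomial (Fin n) k) :=
  Ideal.span ((fun F => ∏ i ∈ F, (X i : MvPolynomial (Fin n) k)) '' S)

/-- The sets that meet every member of `S`. -/
def covers (S : Set (Finset (Fin n))) : Set (Finset (Fin n)) :=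
  {F | ∀ G ∈ S, ∃ i ∈ F, i ∈ G}

/-- The exponent of a squarefree monomial. -/
noncomputable def sqfreeExp (F : Finset (Fin n)) : Fin n →₀ ℕ := ∑ i ∈ F, Finsupp.single i 1

theorem sqfreeExp_apply (F : Finset (Fin n)) (i : Fin n) :
    sqfreeExp F i = if i ∈ F then 1 else 0 := by
  simp [sqfreeExp, Finsupp.finsetSum_apply, Finsupp.single_apply]

theorem prod_X_eq_monomial (F : Finset (Fin n)) :
    ∏ i ∈ F, (X i : MvPolynomial (Fin n) k) = monomial (sqfreeExp F) 1 := by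
  simp [sqfreeExp, monomial_sum_one, X]

theorem sqfreeExp_le_iff (F : Finset (Fin n)) (e : Fin n →₀ ℕ) :
    sqfreeExp F ≤ e ↔ ∀ i ∈ F, e i ≠ 0 := by
  refine ⟨fun h i hi => ?_, fun h i => ?_⟩
  · have := h i
    rw [sqfreeExp_apply, if_pos hi] at this
    omega
  · rw [sqfreeExp_apply]
    split_ifs with hi
    · exact Nat.one_le_iff_ne_zero.mpr (h i hi)
    · exact Nat.zero_le _

theorem mem_sqfreeIdeal_iff (S : Set (Finset (Fin n))) (f : MvPolynomial (Fin n) k) :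
    f ∈ sqfreeIdeal k S ↔ ∀ e ∈ f.support, ∃ F ∈ S, ∀ i ∈ F, e i ≠ 0 := by
  have h := @mem_ideal_span_monomial_image (Fin n) k _ f (sqfreeExp '' S)
  rw [Set.image_image] at h
  simp only [sqfreeIdeal, prod_X_eq_monomial, h, Set.exists_mem_image, sqfreeExp_le_iff]

theorem prod_X_mem_sqfreeIdeal {S : Set (Finset (Fin n))} {F : Finset (Fin n)} (hF : F ∈ S) :
    ∏ i ∈ F, (X i : MvPolynomial (Fin n) k) ∈ sqfreeIdeal k S :=
  Ideal.subset_span ⟨F, hF, rfl⟩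

/-- The ideal depends only on the upper closure of `S`. -/
theorem sqfreeIdeal_mono {S T : Set (Finset (Fin n))} (h : ∀ F ∈ S, ∃ G ∈ T, G ⊆ F) :
    sqfreeIdeal k S ≤ sqfreeIdeal k T := by
  intro f hf
  rw [mem_sqfreeIdeal_iff] at hf ⊢
  intro e he
  obtain ⟨F, hF, hFe⟩ := hf e he
  obtain ⟨G, hG, hGF⟩ := h F hF
  exact ⟨G, hG, fun i hi => hFe i (hGF hi)⟩

/-! ### Monomial prime ideals -/

/-- The prime ideal generated by the variables in `F`. -/
noncomputable def varIdeal (k : Type*) [Field k] {n : ℕ} (F : Finset (Fin n)) :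
    Ideal (MvPolynomial (Fin n) k) :=
  Ideal.span (X '' (F : Set (Fin n)))

/-- The order of vanishing along the coordinate subspace defined by the variables in `F`. -/
noncomputable def ordAlong (F : Finset (Fin n)) (f : MvPolynomial (Fin n) k) : ℕ∞ :=
  MvPowerSeries.weightedOrder (fun i => if i ∈ F then 1 else 0) (f : MvPowerSeries (Fin n) k)

theorem weight_indicator (F : Finset (Fin n)) (e : Fin n →₀ ℕ) :
    Finsupp.weight (fun i => if i ∈ F then 1 else 0) e = ∑ i ∈ F, e i := by
  simp [Finsupp.weight_apply, Finsupp.sum_fintype]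

theorem le_ordAlong_iff (F : Finset (Fin n)) (f : MvPolynomial (Fin n) k) (s : ℕ) :
    (s : ℕ∞) ≤ ordAlong F f ↔ ∀ e ∈ f.support, s ≤ ∑ i ∈ F, e i := by
  refine ⟨fun h e he => ?_, fun h => MvPowerSeries.nat_le_weightedOrder _ fun d hd => ?_⟩
  · have h1 := h.trans (MvPowerSeries.weightedOrder_le _ (d := e)
      (by rwa [coeff_coe, ← mem_support_iff]))
    rw [weight_indicator] at h1
    exact_mod_cast h1
  · rw [weight_indicator] at hd
    rw [coeff_coe]
    by_contra hne
    exact absurd (h d (mem_support_iff.mpr hne)) (by omega)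

/-- Additivity makes `varIdeal` prime, and lets a factor outside that prime, which has order zero,
be cancelled in symbolic powers. -/
theorem ordAlong_mul (F : Finset (Fin n)) (f g : MvPolynomial (Fin n) k) :
    ordAlong F (f * g) = ordAlong F f + ordAlong F g := by
  rw [ordAlong, coe_mul, MvPowerSeries.weightedOrder_mul]
  rfl

theorem mem_varIdeal_iff (F : Finset (Fin n)) (f : MvPolynomial (Fin n) k) :
    f ∈ varIdeal k F ↔ ∀ e ∈ f.support, ∃ i ∈ F, e i ≠ 0 := by
  simp [varIdeal, mem_ideal_span_X_image]

theorem mem_varIdeal_iff_ordAlong (F : Finset (Fin n)) (f : MvPolynomial (Fin n) k) :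
    f ∈ varIdeal k F ↔ ordAlong F f ≠ 0 := by
  rw [mem_varIdeal_iff, ← Order.one_le_iff_ne_zero, ← Nat.cast_one, le_ordAlong_iff]
  refine forall₂_congr fun e _ => ?_
  rw [Nat.one_le_iff_ne_zero, Ne, Finset.sum_eq_zero_iff]
  push Not
  rfl

theorem X_mem_varIdeal_iff (F : Finset (Fin n)) (i : Fin n) :
    (X i : MvPolynomial (Fin n) k) ∈ varIdeal k F ↔ i ∈ F := by
  rw [mem_varIdeal_iff, support_X]
  simp [Finsupp.single_apply]

instance varIdeal_isPrime (F : Finset (Fin n)) : (varIdeal k F).IsPrime := by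
  refine ⟨fun h => ?_, fun {f g} h => ?_⟩
  · have h1 := (mem_varIdeal_iff F (1 : MvPolynomial (Fin n) k)).mp (h ▸ Submodule.mem_top)
    simpa using h1 0 (by simp)
  · rw [mem_varIdeal_iff_ordAlong, ordAlong_mul] at h
    simp only [mem_varIdeal_iff_ordAlong]
    by_contra hc
    push Not at hc
    exact h (by rw [hc.1, hc.2, add_zero])

theorem varsIn_varIdeal (F : Finset (Fin n)) : varsIn (varIdeal k F) = F := by
  ext i
  simp [varsIn, X_mem_varIdeal_iff]

theorem prod_X_mem_varIdeal_iff (F G : Finset (Fin n)) :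
    ∏ i ∈ G, (X i : MvPolynomial (Fin n) k) ∈ varIdeal k F ↔ ∃ i ∈ F, i ∈ G := by
  rw [(varIdeal_isPrime F).prod_mem_iff]
  simp only [X_mem_varIdeal_iff]
  exact ⟨fun ⟨i, a, b⟩ => ⟨i, b, a⟩, fun ⟨i, a, b⟩ => ⟨i, b, a⟩⟩

/-! ### Covers -/

/-- If `F` contains no member of `S`, then its complement meets every member, yet `F` misses its
complement. -/
theorem covers_covers_iff (S : Set (Finset (Fin n))) (F : Finset (Fin n)) :
    F ∈ covers (covers S) ↔ ∃ G ∈ S, G ⊆ F := by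
  constructor
  · intro h
    by_contra hc
    push Not at hc
    obtain ⟨i, hi, hi'⟩ := h Fᶜ fun G hG => by
      obtain ⟨i, hi, hiF⟩ := Finset.not_subset.mp (hc G hG)
      exact ⟨i, Finset.mem_compl.mpr hiF, hi⟩
    exact Finset.mem_compl.mp hi' hi
  · rintro ⟨G, hG, hGF⟩ C hC
    obtain ⟨i, hi, hi'⟩ := hC G hG
    exact ⟨i, hGF hi', hi⟩

theorem exists_minimal_cover {S : Set (Finset (Fin n))} {F : Finset (Fin n)} (hF : F ∈ covers S) :
    ∃ G, Minimal (· ∈ covers S) G ∧ G ⊆ F := by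
  obtain ⟨G, hG, hm⟩ := (Set.toFinite (covers S)).exists_le_minimal hF
  exact ⟨G, hm, hG⟩

/-- By minimality `F.erase i` misses some member of `S`; that member can meet `F` only in `i`. -/
theorem exists_inter_eq_singleton {S : Set (Finset (Fin n))} {F : Finset (Fin n)}
    (hF : Minimal (· ∈ covers S) F) {i : Fin n} (hi : i ∈ F) :
    ∃ G ∈ S, i ∈ G ∧ ∀ j ∈ G, j ∈ F → j = i := by
  have h : F.erase i ∉ covers S := fun h => Finset.notMem_erase i F (hF.2 h (F.erase_subset i) hi)
  simp only [covers, Set.mem_ofPred_eq] at h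
  push Not at h
  obtain ⟨G, hG, hd⟩ := h
  have h1 : ∀ j ∈ G, j ∈ F → j = i := fun j hj hjF => by
    by_contra hne
    exact hd j (Finset.mem_erase.mpr ⟨hne, hjF⟩) hj
  obtain ⟨j, hjF, hj⟩ := hF.1 G hG
  exact ⟨G, hG, h1 j hj hjF ▸ hj, h1⟩

/-! ### Associated primes -/

theorem sqfreeIdeal_le_varIdeal {S : Set (Finset (Fin n))} {F : Finset (Fin n)}
    (hF : F ∈ covers S) : sqfreeIdeal k S ≤ varIdeal k F := by
  refine Ideal.span_le.mpr ?_
  rintro _ ⟨G, hG, rfl⟩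
  exact (prod_X_mem_varIdeal_iff F G).mpr (hF G hG)

/-- This is the prime decomposition of the ideal: a support that meets every cover contains a member
of `S`, by `covers_covers_iff`. -/
theorem mem_sqfreeIdeal_iff_forall_minimal (S : Set (Finset (Fin n)))
    (f : MvPolynomial (Fin n) k) :
    f ∈ sqfreeIdeal k S ↔ ∀ F, Minimal (· ∈ covers S) F → f ∈ varIdeal k F := by
  refine ⟨fun h F hF => sqfreeIdeal_le_varIdeal hF.1 h, fun h => ?_⟩
  rw [mem_sqfreeIdeal_iff]
  intro e he
  have h1 : e.support ∈ covers (covers S) := by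
    intro C hC
    obtain ⟨F, hF, hFC⟩ := exists_minimal_cover hC
    obtain ⟨i, hi, hie⟩ := (mem_varIdeal_iff F f).mp (h F hF) e he
    exact ⟨i, Finsupp.mem_support_iff.mpr hie, hFC hi⟩
  obtain ⟨G, hG, hGe⟩ := (covers_covers_iff S _).mp h1
  exact ⟨G, hG, fun i hi => Finsupp.mem_support_iff.mp (hGe hi)⟩

theorem mem_associatedPrimes_quotient_iff {R : Type*} [CommRing R] [IsNoetherianRing R]
    (I p : Ideal R) :
    p ∈ associatedPrimes R (R ⧸ I) ↔ p.IsPrime ∧ ∃ x : R, ∀ f, f ∈ p ↔ f * x ∈ I := by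
  rw [AssociatedPrimes.mem_iff, isAssociatedPrime_iff, Ideal.Quotient.mk_surjective.exists]
  refine and_congr_right fun _ => exists_congr fun x => ?_
  rw [Ideal.ext_iff]
  refine forall_congr' fun f => iff_congr Iff.rfl ?_
  rw [Submodule.mem_colon_singleton, Submodule.mem_bot, ← Ideal.Quotient.eq_zero_iff_mem, map_mul]
  rfl

theorem mem_associatedPrimes_iff (S : Set (Finset (Fin n)))
    (p : Ideal (MvPolynomial (Fin n) k)) :
    p ∈ associatedPrimes (MvPolynomial (Fin n) k) (MvPolynomial (Fin n) k ⧸ sqfreeIdeal k S) ↔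
      ∃ F, Minimal (· ∈ covers S) F ∧ p = varIdeal k F := by
  classical
  rw [mem_associatedPrimes_quotient_iff]
  constructor
  · rintro ⟨hp, x, hx⟩
    -- The annihilator of `x` is the intersection of the finitely many minimal primes missing `x`;
    -- being prime, it equals one of them.
    let T : Finset (Finset (Fin n)) :=
      Finset.univ.filter fun F => Minimal (· ∈ covers S) F ∧ x ∉ varIdeal k F
    have h : p = T.inf (varIdeal k) := by
      ext f
      rw [hx, mem_sqfreeIdeal_iff_forall_minimal, Submodule.mem_finsetInf]
      simp only [T, Finset.mem_filter, Finset.mem_univ, true_and,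
        (varIdeal_isPrime _).mul_mem_iff_mem_or_mem]
      exact forall_congr' fun F => by tauto
    obtain ⟨F, hF, hpF⟩ := Ideal.eq_inf_of_isPrime_inf (h ▸ hp)
    exact ⟨F, (Finset.mem_filter.mp hF).2.1, h.trans hpF.symm⟩
  · rintro ⟨F, hF, rfl⟩
    -- The witness is the product of the variables outside `F`: adjoining any `X i` with `i ∈ F`
    -- makes it divisible by a generator that meets `F` only in `i`.
    refine ⟨inferInstance, ∏ i ∈ Fᶜ, X i, fun f => ⟨fun hf => ?_, fun hf => ?_⟩⟩
    · have hle : varIdeal k F ≤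
          Submodule.comap (LinearMap.mulRight (MvPolynomial (Fin n) k) (∏ i ∈ Fᶜ, X i))
            (sqfreeIdeal k S) := by
        refine Ideal.span_le.mpr ?_
        rintro _ ⟨i, hi, rfl⟩
        obtain ⟨G, hG, hiG, hGF⟩ := exists_inter_eq_singleton hF hi
        change X i * ∏ j ∈ Fᶜ, X j ∈ sqfreeIdeal k S
        have hi' : i ∉ Fᶜ := by simpa using hi
        rw [← Finset.prod_insert hi']
        refine Ideal.mem_of_dvd _ (Finset.prod_dvd_prod_of_subset _ _ _ fun j hj => ?_)
          (prod_X_mem_sqfreeIdeal hG)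
        by_cases hjF : j ∈ F
        · rw [hGF j hj hjF]
          exact Finset.mem_insert_self _ _
        · exact Finset.mem_insert_of_mem (Finset.mem_compl.mpr hjF)
      exact hle hf
    · refine ((varIdeal_isPrime F).mem_or_mem (sqfreeIdeal_le_varIdeal hF.1 hf)).resolve_right ?_
      rw [prod_X_mem_varIdeal_iff]
      rintro ⟨i, hi, hi'⟩
      exact Finset.mem_compl.mp hi' hi

theorem alexanderDual_sqfreeIdeal (S : Set (Finset (Fin n))) :
    alexanderDual (sqfreeIdeal k S) = sqfreeIdeal k (covers S) := by
  have h : alexanderDual (sqfreeIdeal k S) = sqfreeIdeal k {F | Minimal (· ∈ covers S) F} := by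
    rw [alexanderDual, sqfreeIdeal.eq_def k {F | Minimal (· ∈ covers S) F}]
    congr 1
    ext f
    simp only [Set.mem_image, mem_associatedPrimes_iff, Set.mem_ofPred_eq]
    constructor
    · rintro ⟨_, ⟨F, hF, rfl⟩, rfl⟩
      exact ⟨F, hF, by rw [varsIn_varIdeal]⟩
    · rintro ⟨F, hF, rfl⟩
      exact ⟨_, ⟨F, hF, rfl⟩, by rw [varsIn_varIdeal]⟩
  rw [h]
  exact le_antisymm (sqfreeIdeal_mono fun F hF => ⟨F, hF.1, subset_rfl⟩)
    (sqfreeIdeal_mono fun F hF => exists_minimal_cover hF)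

/-- The points of the nonnegative orthant whose coordinates over each member of `S` have sum at
least `1`. -/
def coveringPolyhedron (S : Set (Finset (Fin n))) : Set (Fin n → ℝ) :=
  {u | (∀ i, 0 ≤ u i) ∧ ∀ F ∈ S, 1 ≤ ∑ i ∈ F, u i}

theorem coveringPolyhedron_mono {S T : Set (Finset (Fin n))} (h : ∀ F ∈ S, ∃ G ∈ T, G ⊆ F) :
    coveringPolyhedron T ⊆ coveringPolyhedron S := by
  refine fun u hu => ⟨hu.1, fun F hF => ?_⟩
  obtain ⟨G, hG, hGF⟩ := h F hF
  exact (hu.2 G hG).trans (Finset.sum_le_sum_of_subset_of_nonneg hGF fun i _ _ => hu.1 i)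

theorem coveringPolyhedron_covers_covers (S : Set (Finset (Fin n))) :
    coveringPolyhedron (covers (covers S)) = coveringPolyhedron S :=
  Set.Subset.antisymm
    (coveringPolyhedron_mono fun F hF =>
      ⟨F, (covers_covers_iff S F).mpr ⟨F, hF, subset_rfl⟩, subset_rfl⟩)
    (coveringPolyhedron_mono fun F hF => (covers_covers_iff S F).mp hF)

theorem symbolicPolyhedron_sqfreeIdeal (S : Set (Finset (Fin n))) :
    symbolicPolyhedron (sqfreeIdeal k S) = coveringPolyhedron (covers S) := by
  ext u
  refine and_congr_right fun hu => ⟨fun h F hF => ?_, fun h p hp => ?_⟩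
  · obtain ⟨G, hG, hGF⟩ := exists_minimal_cover hF
    have := h _ ((mem_associatedPrimes_iff S _).mpr ⟨G, hG, rfl⟩)
    rw [varsIn_varIdeal] at this
    exact this.trans (Finset.sum_le_sum_of_subset_of_nonneg hGF fun i _ _ => hu i)
  · obtain ⟨F, hF, rfl⟩ := (mem_associatedPrimes_iff S _).mp hp
    rw [varsIn_varIdeal]
    exact h F hF.1

/-! ### Weights on powers, and symbolic powers -/

/-- The polynomials all of whose monomials have weight at least `c`. -/
def weightIdeal (k : Type*) [Field k] {n : ℕ} (v : Fin n → ℝ) (hv : ∀ i, 0 ≤ v i) (c : ℝ) :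
    Ideal (MvPolynomial (Fin n) k) where
  carrier := {f | ∀ e ∈ f.support, c ≤ ∑ i, (e i : ℝ) * v i}
  zero_mem' := by simp
  add_mem' := by
    classical
    intro f g hf hg e he
    rcases Finset.mem_union.mp (support_add he) with h | h
    exacts [hf e h, hg e h]
  smul_mem' := by
    classical
    intro g f hf e he
    obtain ⟨d, -, e', he', rfl⟩ := Finset.mem_add.mp (support_mul g f he)
    refine (hf e' he').trans (Finset.sum_le_sum fun i _ => ?_)
    refine mul_le_mul_of_nonneg_right ?_ (hv i)
    simp

theorem weightIdeal_mul_le (v : Fin n → ℝ) (hv : ∀ i, 0 ≤ v i) (c d : ℝ) :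
    weightIdeal k v hv c * weightIdeal k v hv d ≤ weightIdeal k v hv (c + d) := by
  classical
  refine Ideal.mul_le.mpr fun f hf g hg e he => ?_
  obtain ⟨e₁, h₁, e₂, h₂, rfl⟩ := Finset.mem_add.mp (support_mul f g he)
  refine (add_le_add (hf e₁ h₁) (hg e₂ h₂)).trans_eq ?_
  simp [add_mul, Finset.sum_add_distrib]

/-- Each generator has weight at least 1 and weights add. Indicators of covers give the bound for
symbolic powers, general `v` the one for integral closures. -/
theorem sqfreeIdeal_pow_le_weightIdeal {S : Set (Finset (Fin n))} {v : Fin n → ℝ}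
    (hv : ∀ i, 0 ≤ v i) (h : ∀ F ∈ S, 1 ≤ ∑ i ∈ F, v i) (s : ℕ) :
    sqfreeIdeal k S ^ s ≤ weightIdeal k v hv s := by
  induction s with
  | zero =>
    intro f _ e _
    rw [Nat.cast_zero]
    exact Finset.sum_nonneg fun i _ => mul_nonneg (Nat.cast_nonneg _) (hv i)
  | succ s ih =>
    rw [pow_succ, Nat.cast_succ]
    refine (Ideal.mul_mono ih ?_).trans (weightIdeal_mul_le v hv _ _)
    intro f hf e he
    obtain ⟨F, hF, hFe⟩ := (mem_sqfreeIdeal_iff S f).mp hf e he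
    refine (h F hF).trans ((Finset.sum_le_sum fun i hi => ?_).trans
      (Finset.sum_le_sum_of_subset_of_nonneg (Finset.subset_univ F)
        fun i _ _ => mul_nonneg (Nat.cast_nonneg _) (hv i)))
    exact le_mul_of_one_le_left (hv i) (by exact_mod_cast Nat.one_le_iff_ne_zero.mpr (hFe i hi))

theorem le_ordAlong_of_mem_pow {S : Set (Finset (Fin n))} {F : Finset (Fin n)}
    (hF : F ∈ covers S) {s : ℕ} {f : MvPolynomial (Fin n) k} (hf : f ∈ sqfreeIdeal k S ^ s) :
    (s : ℕ∞) ≤ ordAlong F f := by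
  rw [le_ordAlong_iff]
  intro e he
  have h := sqfreeIdeal_pow_le_weightIdeal (v := fun i => if i ∈ F then 1 else 0)
    (fun i => by split_ifs <;> norm_num) (fun G hG => by
      obtain ⟨i, hi, hiG⟩ := hF G hG
      have h0 : ∀ j ∈ G, (0 : ℝ) ≤ if j ∈ F then 1 else 0 := fun j _ => by split_ifs <;> norm_num
      have := Finset.single_le_sum h0 hiG
      simpa [hi] using this) s hf e he
  simp only [mul_ite, mul_one, mul_zero, Finset.sum_ite_mem, Finset.univ_inter] at h
  exact_mod_cast h

/-- After localization each `X i` with `i ∈ F` lies in the ideal: a generator meeting `F` only in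
`i` is `X i` times a unit. -/
theorem monomial_mem_of_minimal_cover {S : Set (Finset (Fin n))} {F : Finset (Fin n)}
    (hF : Minimal (· ∈ covers S) F) {s : ℕ} {e : Fin n →₀ ℕ} (he : s ≤ ∑ i ∈ F, e i) :
    ∃ g ∉ varIdeal k F, g * monomial e 1 ∈ sqfreeIdeal k S ^ s := by
  classical
  have h0 : ∀ i ∈ F, ∃ g ∉ varIdeal k F, g * X i ∈ sqfreeIdeal k S := by
    intro i hi
    obtain ⟨G, hG, hiG, hGF⟩ := exists_inter_eq_singleton hF hi
    refine ⟨∏ j ∈ G.erase i, X j, ?_, ?_⟩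
    · rw [prod_X_mem_varIdeal_iff]
      rintro ⟨j, hjF, hj⟩
      exact (Finset.mem_erase.mp hj).1 (hGF j (Finset.mem_erase.mp hj).2 hjF)
    · rw [Finset.prod_erase_mul _ _ hiG]
      exact prod_X_mem_sqfreeIdeal hG
  choose! g hg hgX using h0
  refine ⟨∏ i ∈ F, g i ^ e i, ?_, ?_⟩
  · rw [(varIdeal_isPrime F).prod_mem_iff]
    rintro ⟨i, hi, h⟩
    exact hg i hi ((varIdeal_isPrime F).mem_of_pow_mem _ h)
  · have h1 : ∏ i ∈ F, (g i * X i) ^ e i ∈ sqfreeIdeal k S ^ s := by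
      refine Ideal.pow_le_pow_right he ?_
      rw [← Finset.prod_pow_eq_pow_sum]
      exact Ideal.prod_mem_prod fun i hi => Ideal.pow_mem_pow (hgX i hi) _
    refine Ideal.mem_of_dvd _ ?_ h1
    simp only [mul_pow, Finset.prod_mul_distrib]
    refine mul_dvd_mul_left _ ?_
    rw [monomial_eq, C_1, one_mul, Finsupp.prod_fintype _ _ (by simp)]
    exact Finset.prod_dvd_prod_of_subset _ _ _ (Finset.subset_univ F)

theorem mem_symbolicPower_iff_forall {R : Type*} [CommRing R] (I : Ideal R) (s : ℕ) (f : R) :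
    f ∈ symbolicPower I s ↔
      ∀ p ∈ associatedPrimes R (R ⧸ I), ∃ g ∉ p, g * f ∈ I ^ s := by
  simp only [symbolicPower, Submodule.mem_iInf, Ideal.mem_comap]
  refine forall₂_congr fun p hp => ?_
  have : p.IsPrime := IsAssociatedPrime.isPrime hp
  rw [IsLocalization.algebraMap_mem_map_algebraMap_iff p.primeCompl]
  rfl

theorem mem_symbolicPower_iff (S : Set (Finset (Fin n))) (s : ℕ) (f : MvPolynomial (Fin n) k) :
    f ∈ symbolicPower (sqfreeIdeal k S) s ↔
      ∀ e ∈ f.support, ∀ F ∈ covers S, s ≤ ∑ i ∈ F, e i := by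
  rw [mem_symbolicPower_iff_forall]
  constructor
  · intro h e he C hC
    obtain ⟨F, hF, hFC⟩ := exists_minimal_cover hC
    obtain ⟨g, hg, hgf⟩ := h _ ((mem_associatedPrimes_iff S _).mpr ⟨F, hF, rfl⟩)
    have h1 := le_ordAlong_of_mem_pow hF.1 hgf
    rw [mem_varIdeal_iff_ordAlong, not_not] at hg
    rw [ordAlong_mul, hg, zero_add, le_ordAlong_iff] at h1
    exact (h1 e he).trans (Finset.sum_le_sum_of_subset hFC)
  · intro h p hp
    obtain ⟨F, hF, rfl⟩ := (mem_associatedPrimes_iff S _).mp hp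
    choose! g hg hgf using fun e (he : e ∈ f.support) =>
      monomial_mem_of_minimal_cover (k := k) hF (h e he F hF.1)
    -- One multiplier must serve all terms of `f`, so the termwise multipliers are multiplied
    -- together.
    refine ⟨∏ e ∈ f.support, g e, ?_, ?_⟩
    · rw [(varIdeal_isPrime F).prod_mem_iff]
      rintro ⟨e, he, h⟩
      exact hg e he h
    · rw [show (∏ e ∈ f.support, g e) * f = ∑ e ∈ f.support,
          (∏ e ∈ f.support, g e) * monomial e (coeff e f) by rw [← Finset.mul_sum, ← f.as_sum]]
      refine Ideal.sum_mem _ fun e he => ?_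
      rw [show monomial e (coeff e f) = C (coeff e f) * monomial e 1 by rw [C_mul_monomial, mul_one],
        mul_left_comm]
      refine Ideal.mul_mem_left _ _ (Ideal.mem_of_dvd _ ?_ (hgf e he))
      exact mul_dvd_mul_right (Finset.dvd_prod_of_mem g he) _

/-! ### Farkas' lemma over an ordered field -/

/-- **Farkas' lemma**: a linear form that is nonnegative wherever finitely many given linear forms
are nonnegative is a nonnegative combination of them. -/
theorem farkas {𝕜 V ι : Type*} [Field 𝕜] [LinearOrder 𝕜] [IsStrictOrderedRing 𝕜] [AddCommGroup V]
    [Module 𝕜 V] (s : Finset ι) (α : ι → V →ₗ[𝕜] 𝕜) (γ : V →ₗ[𝕜] 𝕜)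
    (h : ∀ x, (∀ i ∈ s, 0 ≤ α i x) → 0 ≤ γ x) :
    ∃ c : ι → 𝕜, (∀ i, 0 ≤ c i) ∧ γ = ∑ i ∈ s, c i • α i := by
  classical
  induction s using Finset.induction_on generalizing α γ with
  | empty =>
    refine ⟨0, fun _ => le_rfl, LinearMap.ext fun x => ?_⟩
    have h1 := h x (by simp)
    have h2 := h (-x) (by simp)
    rw [map_neg] at h2
    simpa using le_antisymm (by linarith) h1
  | insert a s ha ih =>
    by_cases h0 : ∀ x, (∀ i ∈ s, 0 ≤ α i x) → 0 ≤ γ x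
    · obtain ⟨c, hc, hγ⟩ := ih α γ h0
      refine ⟨Function.update c a 0, fun i => ?_, ?_⟩
      · by_cases hi : i = a
        · simp [hi]
        · simpa [hi] using hc i
      · rw [Finset.sum_insert ha, Function.update_self, zero_smul, zero_add, hγ]
        refine Finset.sum_congr rfl fun i hi => ?_
        rw [Function.update_of_ne (by rintro rfl; exact ha hi)]
    · push Not at h0
      obtain ⟨y, hy, hγy⟩ := h0
      have hay : α a y < 0 := by
        by_contra! hc
        exact absurd (h y fun i hi => by
          rcases Finset.mem_insert.mp hi with rfl | hi
          exacts [hc, hy i hi]) (not_le.mpr hγy)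
      obtain ⟨z, hz, hγz, haz⟩ : ∃ z, (∀ i ∈ s, 0 ≤ α i z) ∧ γ z < 0 ∧ α a z = -1 := by
        have hp : 0 < (-α a y)⁻¹ := inv_pos.mpr (by linarith)
        refine ⟨(-α a y)⁻¹ • y, fun i hi => ?_, ?_, ?_⟩
        · rw [map_smul]
          exact smul_nonneg hp.le (hy i hi)
        · rw [map_smul, smul_eq_mul]
          exact mul_neg_of_pos_of_neg hp hγy
        · rw [map_smul, smul_eq_mul, inv_neg, neg_mul, inv_mul_cancel₀ hay.ne]
      -- The map `x ↦ x + α a x • z` projects onto the kernel of `α a`. The induction hypothesis is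
      -- applied to the forms composed with it, where the constraint `a` holds trivially.
      obtain ⟨c, hc, hγ⟩ := ih (fun i => α i + α i z • α a) (γ + γ z • α a) (fun x hx => by
        have h1 := h (x + α a x • z) (fun i hi => by
          rcases Finset.mem_insert.mp hi with rfl | hi
          · simp [haz]
          · have := hx i hi
            simp only [LinearMap.add_apply, LinearMap.smul_apply, smul_eq_mul, map_add,
              map_smul] at this ⊢
            linarith)
        simp only [LinearMap.add_apply, LinearMap.smul_apply, smul_eq_mul, map_add,
          map_smul] at h1 ⊢
        linarith)
      -- The coefficient of `α a` collects the correction terms; it is nonnegative because `α i z ≥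
      -- 0` and `γ z < 0`.
      refine ⟨Function.update c a (∑ i ∈ s, c i * α i z - γ z), fun i => ?_, ?_⟩
      · by_cases hi : i = a
        · subst hi
          rw [Function.update_self]
          have := Finset.sum_nonneg fun i hi => mul_nonneg (hc i) (hz i hi)
          linarith
        · simpa [hi] using hc i
      · rw [Finset.sum_insert ha, Function.update_self]
        have h1 : ∑ i ∈ s, Function.update c a (∑ i ∈ s, c i * α i z - γ z) i • α i
            = ∑ i ∈ s, c i • α i := by
          refine Finset.sum_congr rfl fun i hi => ?_
          rw [Function.update_of_ne (by rintro rfl; exact ha hi)]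
        rw [h1]
        refine LinearMap.ext fun x => ?_
        have h2 := LinearMap.congr_fun hγ x
        simp only [LinearMap.add_apply, LinearMap.smul_apply, smul_eq_mul, LinearMap.sum_apply,
          mul_add, Finset.sum_add_distrib, ← mul_assoc, ← Finset.sum_mul] at h2 ⊢
        linear_combination h2

/-- Linear programming duality for fractional packings of the members of `S` into `e`. -/
theorem exists_fractional_packing (S : Finset (Finset (Fin n))) (e : Fin n → ℚ)
    (he : ∀ i, 0 ≤ e i) (r : ℚ)
    (h : ∀ v : Fin n → ℚ, (∀ i, 0 ≤ v i) → (∀ G ∈ S, 1 ≤ ∑ i ∈ G, v i) → r ≤ ∑ i, e i * v i) :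
    ∃ c : Finset (Fin n) → ℚ, (∀ G, 0 ≤ c G) ∧ r ≤ ∑ G ∈ S, c G ∧
      ∀ i, ∑ G ∈ S with i ∈ G, c G ≤ e i := by
  classical
  let coord : Fin n → ((Fin n → ℚ) × ℚ) →ₗ[ℚ] ℚ :=
    fun i => LinearMap.proj i ∘ₗ LinearMap.fst ℚ (Fin n → ℚ) ℚ
  let scale : ((Fin n → ℚ) × ℚ) →ₗ[ℚ] ℚ := LinearMap.snd ℚ (Fin n → ℚ) ℚ
  let α : Option (Fin n) ⊕ Finset (Fin n) → ((Fin n → ℚ) × ℚ) →ₗ[ℚ] ℚ := Sum.elim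
    (fun o => o.elim scale coord) (fun G => ∑ i ∈ G, coord i - scale)
  -- The constraints are homogenized by a scale `t`, with `v / t` the original point; for `t = 0`
  -- nonnegativity suffices. Evaluating the resulting identity on basis vectors gives the packing.
  obtain ⟨c, hc, hγ⟩ := farkas (Finset.univ.disjSum S) α (∑ i, e i • coord i - r • scale) (by
    rintro ⟨v, t⟩ hx
    have ht : 0 ≤ t := hx (Sum.inl none) (by simp)
    have hv : ∀ i, 0 ≤ v i := fun i => hx (Sum.inl (some i)) (by simp)
    have hG : ∀ G ∈ S, t ≤ ∑ i ∈ G, v i := fun G hG => by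
      have := hx (Sum.inr G) (by simpa using hG)
      simpa [α, coord, scale] using this
    have hgoal : r * t ≤ ∑ i, e i * v i := by
      rcases ht.eq_or_lt with rfl | ht
      · rw [mul_zero]
        exact Finset.sum_nonneg fun i _ => mul_nonneg (he i) (hv i)
      · have h1 := h (fun i => v i / t) (fun i => div_nonneg (hv i) ht.le) (fun G hGS => by
          rw [← Finset.sum_div, le_div_iff₀ ht, one_mul]
          exact hG G hGS)
        simp only [← mul_div_assoc, ← Finset.sum_div] at h1
        rwa [le_div_iff₀ ht] at h1
    simpa [coord, scale] using hgoal)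
  rw [Finset.sum_disjSum, Fintype.sum_option] at hγ
  refine ⟨fun G => c (Sum.inr G), fun G => hc _, ?_, fun i => ?_⟩
  · have h1 := LinearMap.congr_fun hγ (0, 1)
    simp [α, coord, scale] at h1
    have := hc (Sum.inl none)
    linarith
  · have h1 := LinearMap.congr_fun hγ (Pi.single i 1, 0)
    simp [α, coord, scale, Pi.single_apply] at h1
    have h2 := hc (Sum.inl (some i))
    rw [Finset.sum_filter]
    linarith

/-! ### Integral closures of powers -/

theorem exists_nat_scaling {ι : Type*} (s : Finset ι) (c : ι → ℚ) (hc : ∀ i, 0 ≤ c i) :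
    ∃ N : ℕ, 1 ≤ N ∧ ∃ p : ι → ℕ, ∀ i ∈ s, (p i : ℚ) = N * c i := by
  refine ⟨∏ i ∈ s, (c i).den, Finset.prod_pos fun i _ => (c i).den_pos,
    fun i => ⌊(∏ j ∈ s, (c j).den : ℕ) * c i⌋₊, fun i hi => ?_⟩
  obtain ⟨d, hd⟩ := Finset.dvd_prod_of_mem (fun i => (c i).den) hi
  have h1 : ((∏ j ∈ s, (c j).den : ℕ) : ℚ) * c i = ((d * (c i).num.toNat : ℕ) : ℚ) := by
    have h2 : (((c i).num.toNat : ℕ) : ℚ) = (c i).num := by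
      exact_mod_cast Int.toNat_of_nonneg (Rat.num_nonneg.mpr (hc i))
    rw [hd, Nat.cast_mul, Nat.cast_mul, h2, ← Rat.den_mul_eq_num]
    ring
  simp only [h1, Nat.floor_natCast]

theorem mem_idealClosure_of_pow_mem {R : Type*} [CommRing R] {I : Ideal R} {x : R} {N : ℕ}
    (hN : 1 ≤ N) (h : x ^ N ∈ I ^ N) : x ∈ idealClosure I := by
  refine ⟨N, fun j => if j = N then -x ^ N else 0, hN, fun j _ => ?_, ?_⟩
  · dsimp only
    split_ifs with hj
    · rw [hj]
      exact neg_mem h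
    · exact zero_mem _
  · rw [Finset.sum_eq_single_of_mem N (Finset.mem_Icc.mpr ⟨hN, le_rfl⟩)]
    · simp
    · intro j _ hj
      simp [hj]

/-- After clearing denominators in an optimal fractional packing, the `N`-th power of the monomial
is divisible by a product of at least `r * N` generators. -/
theorem monomial_mem_idealClosure (S : Set (Finset (Fin n))) (r : ℕ) (e : Fin n →₀ ℕ)
    (h : ∀ v ∈ coveringPolyhedron S, (r : ℝ) ≤ ∑ i, (e i : ℝ) * v i) :
    (monomial e 1 : MvPolynomial (Fin n) k) ∈ idealClosure (sqfreeIdeal k S ^ r) := by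
  classical
  obtain ⟨c, hc, hcr, hce⟩ := exists_fractional_packing (Set.toFinite S).toFinset
    (fun i => (e i : ℚ)) (fun i => Nat.cast_nonneg _) r (fun v hv hG => by
      have := h (fun i => (v i : ℝ)) ⟨fun i => Rat.cast_nonneg.mpr (hv i), fun G hGS => by
        beta_reduce
        exact_mod_cast hG G (by simpa using hGS)⟩
      exact_mod_cast this)
  obtain ⟨N, hN, p, hp⟩ := exists_nat_scaling (Set.toFinite S).toFinset c hc
  refine mem_idealClosure_of_pow_mem hN ?_
  rw [← pow_mul]
  have hN0 : (0 : ℚ) ≤ N := Nat.cast_nonneg _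
  have h1 : r * N ≤ ∑ G ∈ (Set.toFinite S).toFinset, p G := by
    have : (r * N : ℚ) ≤ ∑ G ∈ (Set.toFinite S).toFinset, (p G : ℚ) := by
      rw [Finset.sum_congr rfl hp, ← Finset.mul_sum, mul_comm]
      exact mul_le_mul_of_nonneg_left hcr hN0
    exact_mod_cast this
  have h2 : ∏ G ∈ (Set.toFinite S).toFinset, (∏ i ∈ G, X i : MvPolynomial (Fin n) k) ^ p G ∈
      sqfreeIdeal k S ^ (r * N) := by
    refine Ideal.pow_le_pow_right h1 ?_
    rw [← Finset.prod_pow_eq_pow_sum]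
    exact Ideal.prod_mem_prod fun G hG =>
      Ideal.pow_mem_pow (prod_X_mem_sqfreeIdeal (by simpa using hG)) _
  refine Ideal.mem_of_dvd _ ?_ h2
  simp only [prod_X_eq_monomial, monomial_pow, one_pow]
  rw [← monomial_sum_one, monomial_dvd_monomial]
  refine ⟨Or.inr fun i => ?_, one_dvd _⟩
  have h3 : ((∑ G ∈ (Set.toFinite S).toFinset with i ∈ G, p G : ℕ) : ℚ) ≤ (N * e i : ℕ) := by
    push_cast
    rw [Finset.sum_congr rfl fun G hG => hp G (Finset.mem_filter.mp hG).1, ← Finset.mul_sum]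
    exact mul_le_mul_of_nonneg_left (hce i) hN0
  have h4 : ∑ G ∈ (Set.toFinite S).toFinset with i ∈ G, p G ≤ N * e i := by exact_mod_cast h3
  simpa [Finsupp.finsetSum_apply, sqfreeExp_apply, Finset.sum_filter] using h4

/-- In the integral equation the term at exponent `m • e` must cancel, so some `c j ∈ I ^ j`, where
`I` is the `r`-th power, contains the monomial `j • e`. Its weight is at least `r * j`; divide by
`j`. -/
theorem le_of_monomial_mem_idealClosure {S : Set (Finset (Fin n))} {r : ℕ} {e : Fin n →₀ ℕ}
    (h : (monomial e 1 : MvPolynomial (Fin n) k) ∈ idealClosure (sqfreeIdeal k S ^ r))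
    {v : Fin n → ℝ} (hv : v ∈ coveringPolyhedron S) :
    (r : ℝ) ≤ ∑ i, (e i : ℝ) * v i := by
  obtain ⟨m, c, -, hc, hx⟩ := h
  have h1 := congrArg (coeff (m • e)) hx
  simp only [monomial_pow, one_pow, coeff_add, coeff_monomial, if_true, coeff_sum, coeff_zero] at h1
  have h2 : ∑ j ∈ Finset.Icc 1 m, coeff (m • e) (c j * monomial ((m - j) • e) 1) ≠ 0 :=
    fun h0 => by simp [h0] at h1
  obtain ⟨j, hj, hne⟩ := Finset.exists_ne_zero_of_sum_ne_zero h2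
  have hj' := Finset.mem_Icc.mp hj
  rw [show m • e = j • e + (m - j) • e by rw [← add_smul, Nat.add_sub_cancel' hj'.2],
    coeff_mul_monomial, mul_one] at hne
  have h3 := hc j hj
  rw [← pow_mul] at h3
  have h4 := sqfreeIdeal_pow_le_weightIdeal hv.1 hv.2 _ h3 _ (mem_support_iff.mpr hne)
  have h5 : ∑ i, ((j • e) i : ℝ) * v i = (∑ i, (e i : ℝ) * v i) * j := by
    rw [Finset.sum_mul]
    refine Finset.sum_congr rfl fun i _ => ?_
    simp
    ring
  rw [h5, Nat.cast_mul] at h4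
  exact le_of_mul_le_mul_right h4 (by exact_mod_cast hj'.1)

/-! ### Asymptotic resurgence -/

theorem symbolicPower_le_idealClosure_iff (S T : Set (Finset (Fin n))) (s r : ℕ) :
    symbolicPower (sqfreeIdeal k S) s ≤ idealClosure (sqfreeIdeal k T ^ r) ↔
      ∀ e : Fin n →₀ ℕ, (∀ F ∈ covers S, s ≤ ∑ i ∈ F, e i) →
        ∀ v ∈ coveringPolyhedron T, (r : ℝ) ≤ ∑ i, (e i : ℝ) * v i := by
  classical
  constructor
  · intro h e he v hv
    refine le_of_monomial_mem_idealClosure (k := k) (h ?_) hv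
    rw [mem_symbolicPower_iff]
    intro e' he'
    rw [support_monomial, if_neg one_ne_zero, Finset.mem_singleton] at he'
    exact he' ▸ he
  · intro h f hf
    rw [mem_symbolicPower_iff] at hf
    rw [f.as_sum]
    refine Ideal.sum_mem _ fun e he => ?_
    rw [show monomial e (coeff e f) = C (coeff e f) * monomial e 1 by rw [C_mul_monomial, mul_one]]
    exact Ideal.mul_mem_left _ _ (monomial_mem_idealClosure T r e (h e (hf e he)))

/-- In the first case no exponent satisfies the symbolic condition; in the second the covering
polyhedron is empty. Either way containment holds for all `t ≥ 1`. -/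
theorem rhoHat_eq_bot {S T : Set (Finset (Fin n))} (h : ∅ ∈ covers S ∨ ∅ ∈ T) :
    rhoHat (sqfreeIdeal k S) (sqfreeIdeal k T) = ⊥ := by
  rw [rhoHat, asympResurgence, sSup_eq_bot]
  rintro _ ⟨s, r, hs, -, ht, -⟩
  obtain ⟨t, ht, ht1⟩ := (ht.and (eventually_ge_atTop 1)).exists
  refine absurd ((symbolicPower_le_idealClosure_iff S T _ _).mpr fun e he v hv => ?_) ht
  rcases h with h | h
  · have h1 := he ∅ h
    have h2 : 1 ≤ s * t := Nat.mul_pos hs ht1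
    simp at h1
    omega
  · have h1 := hv.2 ∅ h
    norm_num at h1

/-- The containment of symbolic powers in integral closures fails for large exponents exactly
when the minimal product of the two polyhedra is too small. -/
theorem eventually_not_le_iff {S T : Set (Finset (Fin n))} {m : ℝ}
    (hm : IsLeast {q : ℝ | ∃ u ∈ coveringPolyhedron (covers S), ∃ v ∈ coveringPolyhedron T,
      q = ∑ i, u i * v i} m) {s r : ℕ} (hs : 1 ≤ s) :
    (∀ᶠ t : ℕ in atTop,
      ¬ symbolicPower (sqfreeIdeal k S) (s * t) ≤ idealClosure (sqfreeIdeal k T ^ (r * t))) ↔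
      s * m < r := by
  constructor
  · intro h
    by_contra! hc
    obtain ⟨t, ht, ht1⟩ := (h.and (eventually_ge_atTop 1)).exists
    refine ht ((symbolicPower_le_idealClosure_iff S T _ _).mpr fun e he v hv => ?_)
    have h0 : (0 : ℝ) < (s * t : ℕ) := by exact_mod_cast Nat.mul_pos hs ht1
    have h1 : m ≤ ∑ i, (e i / (s * t : ℕ) : ℝ) * v i := by
      refine hm.2 ⟨_, ⟨fun i => by positivity, fun F hF => ?_⟩, v, hv, rfl⟩
      rw [← Finset.sum_div, le_div_iff₀ h0, one_mul]
      exact_mod_cast he F hF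
    simp only [div_mul_eq_mul_div, ← Finset.sum_div] at h1
    rw [le_div_iff₀ h0] at h1
    refine le_trans ?_ h1
    push_cast
    nlinarith [mul_le_mul_of_nonneg_right hc (Nat.cast_nonneg (α := ℝ) t)]
  · intro h
    obtain ⟨⟨u, hu, v, hv, rfl⟩, -⟩ := hm
    have h1 : Tendsto (fun t : ℕ => (t : ℝ) * (r - s * ∑ i, u i * v i)) atTop atTop :=
      tendsto_natCast_atTop_atTop.atTop_mul_const (sub_pos.mpr h)
    filter_upwards [h1.eventually_gt_atTop (∑ i, v i)] with t ht hle
    rw [symbolicPower_le_idealClosure_iff] at hle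
    -- Rounding up keeps the point in the scaled polyhedron and raises its product with `v` by at
    -- most `∑ i, v i`, less than the gap in `ht`.
    have h2 := hle (Finsupp.equivFunOnFinite.symm fun i => ⌈(s * t : ℝ) * u i⌉₊) (fun F hF => by
      have : ((s * t : ℕ) : ℝ) ≤ ∑ i ∈ F, (⌈(s * t : ℝ) * u i⌉₊ : ℝ) := by
        refine le_trans ?_ (Finset.sum_le_sum fun i _ => Nat.le_ceil _)
        rw [← Finset.mul_sum, Nat.cast_mul]
        exact le_mul_of_one_le_right (by positivity) (hu.2 F hF)
      exact_mod_cast this) v hv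
    have h3 : ∑ i, (⌈(s * t : ℝ) * u i⌉₊ : ℝ) * v i ≤ ∑ i, ((s * t : ℝ) * u i + 1) * v i :=
      Finset.sum_le_sum fun i _ => mul_le_mul_of_nonneg_right
        (Nat.ceil_lt_add_one (mul_nonneg (by positivity) (hu.1 i))).le (hv.1 i)
    simp only [add_mul, one_mul, Finset.sum_add_distrib, mul_assoc, ← Finset.mul_sum] at h3
    simp only [Finsupp.equivFunOnFinite_symm_apply_apply, mul_assoc] at h2
    push_cast at h2
    nlinarith

theorem coe_lt_inv_ofReal_iff {x m : ℝ} (hm : 0 ≤ m) :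
    (x : EReal) < (((ENNReal.ofReal m)⁻¹ : ENNReal) : EReal) ↔ x * m < 1 := by
  rcases hm.eq_or_lt with rfl | hm
  · simp [EReal.coe_lt_top]
  · rw [← ENNReal.ofReal_inv_of_pos hm, EReal.coe_ennreal_ofReal,
      max_eq_left (inv_nonneg.mpr hm.le), EReal.coe_lt_coe_iff, ← one_div,
      lt_div_iff₀ hm]

theorem sSup_ratios_eq_inv {m : ℝ} (hm : 0 ≤ m) :
    sSup {q : EReal | ∃ s r : ℕ, 1 ≤ s ∧ 1 ≤ r ∧ s * m < r ∧ q = (((s : ℝ) / (r : ℝ) : ℝ) : EReal)}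
      = (((ENNReal.ofReal m)⁻¹ : ENNReal) : EReal) := by
  refine le_antisymm (sSup_le ?_) (le_of_forall_lt fun c hc => ?_)
  · rintro _ ⟨s, r, -, hr, h, rfl⟩
    refine ((coe_lt_inv_ofReal_iff hm).mpr ?_).le
    have hr' : (0 : ℝ) < r := by exact_mod_cast hr
    rwa [div_mul_eq_mul_div, div_lt_one hr']
  · have h0 : ((0 : ℝ) : EReal) < (((ENNReal.ofReal m)⁻¹ : ENNReal) : EReal) :=
      (coe_lt_inv_ofReal_iff hm).mpr (by norm_num)
    -- Taking `q` above 0 as well as above `c` makes its numerator a positive natural number.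
    obtain ⟨q, hq, hqm⟩ := EReal.lt_iff_exists_rat_btwn.mp (max_lt hc h0)
    have hq0 : (0 : ℚ) < q := by
      exact_mod_cast EReal.coe_lt_coe_iff.mp ((le_max_right _ _).trans_lt hq)
    rw [coe_lt_inv_ofReal_iff hm] at hqm
    have hnum : (q.num.toNat : ℝ) = q.num := by
      exact_mod_cast Int.toNat_of_nonneg (Rat.num_nonneg.mpr hq0.le)
    have hden : (0 : ℝ) < q.den := by exact_mod_cast q.den_pos
    have hqe : (q : ℝ) = (q.num.toNat : ℝ) / q.den := by rw [hnum, ← Rat.cast_def]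
    refine ((le_max_left _ _).trans_lt hq).trans_le
      (le_sSup ⟨q.num.toNat, q.den, ?_, q.den_pos, ?_, ?_⟩)
    · have := Rat.num_pos.mpr hq0
      omega
    · rwa [hqe, div_mul_eq_mul_div, div_lt_one hden] at hqm
    · rw [hqe]

theorem rhoHat_eq_inv {S T : Set (Finset (Fin n))} {m : ℝ}
    (hm : IsLeast {q : ℝ | ∃ u ∈ coveringPolyhedron (covers S), ∃ v ∈ coveringPolyhedron T,
      q = ∑ i, u i * v i} m) :
    rhoHat (sqfreeIdeal k S) (sqfreeIdeal k T) = (((ENNReal.ofReal m)⁻¹ : ENNReal) : EReal) := by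
  have h0 : 0 ≤ m := by
    obtain ⟨⟨u, hu, v, hv, rfl⟩, -⟩ := hm
    exact Finset.sum_nonneg fun i _ => mul_nonneg (hu.1 i) (hv.1 i)
  rw [rhoHat, asympResurgence, ← sSup_ratios_eq_inv h0]
  congr 1
  ext q
  refine exists_congr fun s => exists_congr fun r => and_congr_right fun hs =>
    and_congr_right fun _ => and_congr_left' (eventually_not_le_iff hm hs)

/-! ### Existence of the minimum -/

theorem one_mem_coveringPolyhedron {S : Set (Finset (Fin n))} (h : ∅ ∉ S) :
    (1 : Fin n → ℝ) ∈ coveringPolyhedron S := by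
  refine ⟨fun _ => zero_le_one, fun F hF => ?_⟩
  have : F.Nonempty := Finset.nonempty_iff_ne_empty.mpr fun h0 => h (h0 ▸ hF)
  simpa using this

/-- A coordinate truncated to 1 satisfies by itself every constraint involving it. Truncation cannot
increase the product, so minimizing over the compact unit cube suffices. -/
theorem inf_one_mem_coveringPolyhedron {S : Set (Finset (Fin n))} {u : Fin n → ℝ}
    (hu : u ∈ coveringPolyhedron S) : u ⊓ 1 ∈ coveringPolyhedron S := by
  have h0 : ∀ i, 0 ≤ (u ⊓ 1) i := fun i => le_inf (hu.1 i) zero_le_one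
  refine ⟨h0, fun F hF => ?_⟩
  by_cases h : ∃ i ∈ F, 1 ≤ u i
  · obtain ⟨i, hi, h1⟩ := h
    refine le_trans ?_ (Finset.single_le_sum (fun j _ => h0 j) hi)
    exact le_inf h1 le_rfl
  · push Not at h
    refine (hu.2 F hF).trans_eq (Finset.sum_congr rfl fun i hi => ?_)
    exact (inf_eq_left.mpr (h i hi).le).symm

theorem isCompact_coveringPolyhedron_inter (S : Set (Finset (Fin n))) :
    IsCompact (coveringPolyhedron S ∩ Set.Icc 0 1) := by
  refine isCompact_Icc.inter_left ?_
  simp only [coveringPolyhedron, Set.ofPred_and, Set.ofPred_forall]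
  exact (isClosed_iInter fun i => isClosed_le continuous_const (continuous_apply i)).inter
    (isClosed_iInter fun F => isClosed_iInter fun _ => isClosed_le continuous_const
      (continuous_finsetSum _ fun i _ => continuous_apply i))

theorem exists_isLeast_product {S T : Set (Finset (Fin n))} (hS : ∅ ∉ S) (hT : ∅ ∉ T) :
    ∃ m : ℝ, IsLeast {q : ℝ | ∃ u ∈ coveringPolyhedron S, ∃ v ∈ coveringPolyhedron T,
      q = ∑ i, u i * v i} m := by
  have h1 : (1 : Fin n → ℝ) ∈ Set.Icc (0 : Fin n → ℝ) 1 := ⟨zero_le_one, le_rfl⟩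
  obtain ⟨⟨u, v⟩, ⟨hu, hv⟩, hmin⟩ := ((isCompact_coveringPolyhedron_inter S).prod
    (isCompact_coveringPolyhedron_inter T)).exists_isMinOn
    ⟨(1, 1), ⟨one_mem_coveringPolyhedron hS, h1⟩, one_mem_coveringPolyhedron hT, h1⟩
    (f := fun p : (Fin n → ℝ) × (Fin n → ℝ) => ∑ i, p.1 i * p.2 i) (by fun_prop)
  refine ⟨∑ i, u i * v i, ⟨u, hu.1, v, hv.1, rfl⟩, ?_⟩
  rintro _ ⟨x, hx, y, hy, rfl⟩
  have hx' := inf_one_mem_coveringPolyhedron hx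
  have hy' := inf_one_mem_coveringPolyhedron hy
  have h2 : ∑ i, u i * v i ≤ ∑ i, (x ⊓ 1) i * (y ⊓ 1) i :=
    hmin (a := (x ⊓ 1, y ⊓ 1)) ⟨⟨hx', hx'.1, inf_le_right⟩, hy', hy'.1, inf_le_right⟩
  exact h2.trans (Finset.sum_le_sum fun i _ =>
    mul_le_mul inf_le_left inf_le_left (hy'.1 i) (hx.1 i))

/-! ### Duality -/

theorem rhoHat_eq_inv_dual {S T : Set (Finset (Fin n))} {m : ℝ}
    (hm : IsLeast {q : ℝ | ∃ u ∈ coveringPolyhedron (covers S), ∃ v ∈ coveringPolyhedron T,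
      q = ∑ i, u i * v i} m) :
    rhoHat (sqfreeIdeal k (covers T)) (sqfreeIdeal k (covers S)) =
      (((ENNReal.ofReal m)⁻¹ : ENNReal) : EReal) := by
  refine rhoHat_eq_inv ?_
  rw [coveringPolyhedron_covers_covers]
  convert hm using 1
  ext q
  constructor <;> rintro ⟨u, hu, v, hv, rfl⟩ <;>
    exact ⟨v, hv, u, hu, Finset.sum_congr rfl fun i _ => mul_comm _ _⟩

theorem rhoHat_covers_eq (S T : Set (Finset (Fin n))) :
    rhoHat (sqfreeIdeal k S) (sqfreeIdeal k T) =
      rhoHat (sqfreeIdeal k (covers T)) (sqfreeIdeal k (covers S)) := by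
  by_cases h : ∅ ∈ covers S ∨ ∅ ∈ T
  · rw [rhoHat_eq_bot h, rhoHat_eq_bot]
    exact h.symm.imp_left fun h => (covers_covers_iff T _).mpr ⟨∅, h, subset_rfl⟩
  · push Not at h
    obtain ⟨m, hm⟩ := exists_isLeast_product h.1 h.2
    rw [rhoHat_eq_inv hm, rhoHat_eq_inv_dual hm]

theorem empty_notMem_of_sqfreeIdeal_ne_top {T : Set (Finset (Fin n))}
    (h : sqfreeIdeal k T ≠ ⊤) : ∅ ∉ T := by
  intro h0
  have h1 := prod_X_mem_sqfreeIdeal (k := k) h0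
  rw [Finset.prod_empty] at h1
  exact h ((Ideal.eq_top_iff_one _).mpr h1)

theorem empty_notMem_covers_of_sqfreeIdeal_ne_bot {S : Set (Finset (Fin n))}
    (h : sqfreeIdeal k S ≠ ⊥) : ∅ ∉ covers S := by
  intro h0
  refine h (Ideal.span_eq_bot.mpr ?_)
  rintro _ ⟨G, hG, -⟩
  obtain ⟨i, hi, -⟩ := h0 G hG
  exact absurd hi (Finset.notMem_empty i)

end MonomialResurgence

open MonomialResurgence in
theorem corollary2p10 {k : Type*} [Field k] {n : ℕ} (a b : Ideal (MvPolynomial (Fin n) k))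
    (ha : IsSquarefreeMonomial a) (hb : IsSquarefreeMonomial b) :
    (a ≠ ⊥ → b ≠ ⊤ → ∃ m : ℝ,
      IsLeast {q : ℝ | ∃ u ∈ symbolicPolyhedron a, ∃ v ∈ symbolicPolyhedron (alexanderDual b),
        q = ∑ i, u i * v i} m ∧
      -- the reciprocal of the minimum, with `1 / 0 = ∞`
      rhoHat a b = (((ENNReal.ofReal m)⁻¹ : ENNReal) : EReal) ∧
      (((ENNReal.ofReal m)⁻¹ : ENNReal) : EReal) =
        rhoHat (alexanderDual b) (alexanderDual a)) ∧
    rhoHat a b = rhoHat (alexanderDual b) (alexanderDual a) ∧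
    rhoHat a a = rhoHat (alexanderDual a) (alexanderDual a) := by
  obtain ⟨S, rfl⟩ := ha
  obtain ⟨T, rfl⟩ := hb
  change (sqfreeIdeal k S ≠ ⊥ → sqfreeIdeal k T ≠ ⊤ → ∃ m : ℝ,
      IsLeast {q : ℝ | ∃ u ∈ symbolicPolyhedron (sqfreeIdeal k S),
        ∃ v ∈ symbolicPolyhedron (alexanderDual (sqfreeIdeal k T)), q = ∑ i, u i * v i} m ∧
      rhoHat (sqfreeIdeal k S) (sqfreeIdeal k T) = (((ENNReal.ofReal m)⁻¹ : ENNReal) : EReal) ∧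
      (((ENNReal.ofReal m)⁻¹ : ENNReal) : EReal) =
        rhoHat (alexanderDual (sqfreeIdeal k T)) (alexanderDual (sqfreeIdeal k S))) ∧
    rhoHat (sqfreeIdeal k S) (sqfreeIdeal k T) =
      rhoHat (alexanderDual (sqfreeIdeal k T)) (alexanderDual (sqfreeIdeal k S)) ∧
    rhoHat (sqfreeIdeal k S) (sqfreeIdeal k S) =
      rhoHat (alexanderDual (sqfreeIdeal k S)) (alexanderDual (sqfreeIdeal k S))
  simp only [alexanderDual_sqfreeIdeal, symbolicPolyhedron_sqfreeIdeal,
    coveringPolyhedron_covers_covers]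
  refine ⟨fun hS hT => ?_, rhoHat_covers_eq S T, rhoHat_covers_eq S S⟩
  obtain ⟨m, hm⟩ := exists_isLeast_product (empty_notMem_covers_of_sqfreeIdeal_ne_bot hS)
    (empty_notMem_of_sqfreeIdeal_ne_top hT)
  exact ⟨m, hm, rhoHat_eq_inv hm, (rhoHat_eq_inv_dual hm).symm⟩
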